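/- For positive integers $m,n,t,q$, an $m\times n$ matrix with entries in $\{0,1,\dots,q-1\}$ is called a ($q$-ary) $t$-covering array if, for any choice of $t$ distinct columns, each of the $q^t$ vectors in $\{0,1,\dots,q-1\}^t$ occurs in at least one row of the submatrix formed by these columns. It is called binary if $q=2$. Let $CAN(t,n,q)$ denote the smallest $m$ for which an $m\times n$ $q$-ary $t$-covering array exists. **Theorem.** There is no $48\times 13$ binary $5$-covering array. Moreover, $CAN(5,13,2)\ge 49$. -/

import Mathlib

/-- An `m × n` matrix `C` over `{0, …, q - 1}` is a `t`-covering array if in any `t` distinct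
columns of `C` each of the `q ^ t` vectors of length `t` occurs in at least one row. -/
def IsCoveringArray {m n q : ℕ} (t : ℕ) (C : Matrix (Fin m) (Fin n) (Fin q)) : Prop :=
  ∀ (c : Fin t ↪ Fin n) (v : Fin t → Fin q), ∃ r : Fin m, ∀ j : Fin t, C r (c j) = v j

/-- The covering array number: the least number `m` of rows for which an `m × n` covering array of
strength `t` over `{0, …, q - 1}` exists. -/
noncomputable def CAN (t n q : ℕ) : ℕ :=
  sInf {m : ℕ | ∃ C : Matrix (Fin m) (Fin n) (Fin q), IsCoveringArray t C}

/-- For `0 < q` the infimum defining `CAN t n q` is a minimum: covering arrays exist (take all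
vectors of length `n` as rows). -/
theorem exists_isCoveringArray (t n q : ℕ) (hq : 0 < q) :
    ∃ C : Matrix (Fin (CAN t n q)) (Fin n) (Fin q), IsCoveringArray t C := by
  have hne : {m : ℕ | ∃ C : Matrix (Fin m) (Fin n) (Fin q), IsCoveringArray t C}.Nonempty := by
    refine ⟨Fintype.card (Fin n → Fin q),
      fun r => (Fintype.equivFin (Fin n → Fin q)).symm r, ?_⟩
    intro c v
    refine ⟨Fintype.equivFin (Fin n → Fin q) (Function.extend c v fun _ => ⟨0, hq⟩), fun j => ?_⟩
    simp [c.injective.extend_apply]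
  exact Nat.sInf_mem hne

/-! Fix a pattern on three columns. Its rows cover all pairs among the other ten columns, and
Sperner's theorem shows that this takes at least six rows and that, with exactly six, every column
is balanced 3-3. Since 48 = 8 · 6, an array with at most 48 rows has exactly six rows per pattern,
hence is an orthogonal array of strength four. Rao's argument then gives 78 = C(13,2) orthogonal
nonzero vectors in a space of dimension at most 48. -/

open Finset in
/-- In an array with at most six rows and at least ten columns that covers all pairs of columns,
every symbol occurs at least three times in every column. -/
theorem three_le_card_of_pairwise_covering {ι κ : Type*} [DecidableEq ι] [DecidableEq κ]
    (A : ι → κ → Fin 2) (R : Finset ι) (K : Finset κ) (hR : #R ≤ 6) (hK : 10 ≤ #K)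
    (hcov : ∀ i ∈ K, ∀ j ∈ K, i ≠ j → ∀ a b, ∃ r ∈ R, A r i = a ∧ A r j = b)
    (i : κ) (hi : i ∈ K) (a : Fin 2) : 3 ≤ #{r ∈ R | A r i = a} := by
  by_contra! hlt
  set P := {r ∈ R | A r i = a}
  have hsplit : ∀ j ∈ K.erase i, ∀ b, ∃ r ∈ P, A r j = b := by
    intro j hj b
    obtain ⟨hji, hj⟩ := mem_erase.1 hj
    obtain ⟨r, hr, h1, h2⟩ := hcov i hi j hj hji.symm a b
    exact ⟨r, mem_filter.2 ⟨hr, h1⟩, h2⟩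
  have hKi : 9 ≤ #(K.erase i) := by rw [card_erase_of_mem hi]; omega
  obtain ⟨j₀, hj₀⟩ : (K.erase i).Nonempty := card_pos.1 (by omega)
  have hP2 : #P = 2 := by
    obtain ⟨r, hr, h0⟩ := hsplit j₀ hj₀ 0
    obtain ⟨s, hs, h1⟩ := hsplit j₀ hj₀ 1
    have : 1 < #P := one_lt_card.2 ⟨r, hr, s, hs, by rintro rfl; simp [h0] at h1⟩
    omega
  obtain ⟨p, q, -, hpq⟩ := card_eq_two.1 hP2
  have hne : ∀ j ∈ K.erase i, A p j ≠ A q j := by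
    intro j hj h
    obtain ⟨r, hr, h0⟩ := hsplit j hj (A p j + 1)
    have : A r j = A p j := by
      rw [hpq, mem_insert, mem_singleton] at hr
      rcases hr with rfl | rfl
      · rfl
      · exact h.symm
    rw [this] at h0
    revert h0
    generalize A p j = x
    revert x
    decide
  -- The rows of `P` are `p` and `q`, which differ in every column `j ≠ i`. So a row with `A p j` in
  -- column `j` and the opposite of `A p k` in column `k` lies outside `P`, in `F j` but not in `F
  -- k`.
  let F : κ → Finset (R \ P : Finset ι) := fun j => {r | A r j = A p j}
  have hF : ∀ j ∈ K.erase i, ∀ k ∈ K.erase i, j ≠ k → ¬ F j ⊆ F k := by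
    intro j hj k hk hjk hsub
    obtain ⟨r, hr, h1, h2⟩ := hcov j (mem_of_mem_erase hj) k (mem_of_mem_erase hk) hjk
      (A p j) (A p k + 1)
    have hx : ∀ x : Fin 2, x + 1 ≠ x := by decide
    have hrP : r ∉ P := by
      rw [hpq, mem_insert, mem_singleton]
      rintro (rfl | rfl)
      · exact hx _ h2.symm
      · exact hne j hj h1.symm
    have := @hsub ⟨r, mem_sdiff.2 ⟨hr, hrP⟩⟩ (by simpa [F] using h1)
    simp only [F, mem_filter, mem_univ, true_and] at this
    exact hx _ (h2.symm.trans this)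
  have hanti : IsAntichain (· ⊆ ·)
      (SetLike.coe ((K.erase i).image F) : Set (Finset (R \ P : Finset ι))) := by
    intro s hs t ht hst
    obtain ⟨j, hj, rfl⟩ := mem_image.1 hs
    obtain ⟨k, hk, rfl⟩ := mem_image.1 ht
    exact hF j hj k hk (by rintro rfl; exact hst rfl)
  have hinj : Set.InjOn F (K.erase i) := by
    intro j hj k hk h
    by_contra hjk
    exact hF j hj k hk hjk h.subset
  have hsp := hanti.sperner
  rw [card_image_of_injOn hinj, Fintype.card_coe] at hsp
  have hcard : #(R \ P) ≤ 4 := by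
    have := card_sdiff_of_subset (show P ⊆ R from filter_subset _ _)
    omega
  -- Nine sets cannot form an antichain on at most four points.
  have : ∀ n ≤ 4, n.choose (n / 2) ≤ 6 := by decide
  have := this _ hcard
  omega

/-- A covering array realizes every prescription of entries on at most `t` columns. -/
theorem IsCoveringArray.exists_row {m n q t : ℕ} {C : Matrix (Fin m) (Fin n) (Fin q)}
    (hC : IsCoveringArray t C) (ht : t ≤ n) (s : Finset (Fin n)) (hs : s.card ≤ t)
    (u : Fin n → Fin q) : ∃ r, ∀ j ∈ s, C r j = u j := by
  obtain ⟨s', hss', -, hs'⟩ := Finset.exists_subsuperset_card_eq (Finset.subset_univ s) hs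
    (by simpa using ht)
  obtain ⟨r, hr⟩ := hC (s'.orderEmbOfFin hs').toEmbedding (fun k => u (s'.orderEmbOfFin hs' k))
  refine ⟨r, fun j hj => ?_⟩
  have : j ∈ Set.range (s'.orderEmbOfFin hs') := by
    rw [Finset.range_orderEmbOfFin]; exact hss' hj
  obtain ⟨k, rfl⟩ := this
  exact hr k

open Finset in
/-- The rows of a binary `5`-covering array on `13` columns with a given pattern on three columns:
if there are at most six of them, every symbol occurs at least three times in every other column. -/
theorem IsCoveringArray.three_le_card_fiber {m : ℕ} {C : Matrix (Fin m) (Fin 13) (Fin 2)}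
    (hC : IsCoveringArray 5 C) (T : Finset (Fin 13)) (hT : #T = 3) (p : T → Fin 2)
    (hle : #{r | (fun j : T => C r j) = p} ≤ 6) (i : Fin 13) (hi : i ∉ T) (a : Fin 2) :
    3 ≤ #{r ∈ ({r | (fun j : T => C r j) = p} : Finset (Fin m)) | C r i = a} := by
  refine three_le_card_of_pairwise_covering C _ Tᶜ hle (by simp [card_compl, hT]) ?_ i
    (by simpa using hi) a
  intro j hj k hk hjk b c
  rw [mem_compl] at hj hk
  obtain ⟨r, hr⟩ := hC.exists_row (by norm_num) (insert j (insert k T))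
    ((card_insert_le _ _).trans (by have := card_insert_le k T; omega))
    (fun l => if l = j then b else if l = k then c else if h : l ∈ T then p ⟨l, h⟩ else 0)
  refine ⟨r, ?_, by simpa using hr j (by simp), by simpa [hjk.symm] using hr k (by simp)⟩
  simp only [mem_filter, mem_univ, true_and]
  funext ⟨l, hl⟩
  have h1 : l ≠ j := by rintro rfl; exact hj hl
  have h2 : l ≠ k := by rintro rfl; exact hk hl
  simpa [h1, h2, hl] using hr l (by simp [hl])

open Finset in
theorem IsCoveringArray.six_le_card_fiber {m : ℕ} {C : Matrix (Fin m) (Fin 13) (Fin 2)}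
    (hC : IsCoveringArray 5 C) (T : Finset (Fin 13)) (hT : #T = 3) (p : T → Fin 2) :
    6 ≤ #{r | (fun j : T => C r j) = p} := by
  by_contra! hlt
  obtain ⟨i, hi⟩ : ∃ i, i ∉ T := by
    by_contra! h
    have := card_le_card (fun i _ => h i : (univ : Finset (Fin 13)) ⊆ T)
    simp [hT] at this
  have h0 := hC.three_le_card_fiber T hT p hlt.le i hi 0
  have h1 := hC.three_le_card_fiber T hT p hlt.le i hi 1
  have hd := card_filter_add_card_filter_not (s := {r | (fun j : T => C r j) = p})
    (fun r => C r i = 0)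
  simp only [show ∀ x : Fin 2, ¬ x = 0 ↔ x = 1 by decide] at hd
  omega

open Finset in
/-- With at most `48` rows, every pattern on three columns occurs exactly six times. -/
theorem IsCoveringArray.card_fiber_eq_six {m : ℕ} {C : Matrix (Fin m) (Fin 13) (Fin 2)}
    (hC : IsCoveringArray 5 C) (hm : m ≤ 48) (T : Finset (Fin 13)) (hT : #T = 3)
    (p : T → Fin 2) : #{r | (fun j : T => C r j) = p} = 6 := by
  refine le_antisymm ?_ (hC.six_le_card_fiber T hT p)
  have hsum := card_eq_sum_card_fiberwise (s := (univ : Finset (Fin m)))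
    (f := fun r => (fun j : T => C r j)) (t := univ) (fun _ _ => mem_coe.2 (mem_univ _))
  rw [card_univ, Fintype.card_fin, ← add_sum_erase _ _ (mem_univ p)] at hsum
  -- The other seven patterns use at least 42 of the at most 48 rows.
  have hge : #(univ.erase p) • 6 ≤
      ∑ p' ∈ univ.erase p, #{r | (fun j : T => C r j) = p'} :=
    card_nsmul_le_sum _ _ _ fun p' _ => hC.six_le_card_fiber T hT p'
  rw [card_erase_of_mem (mem_univ p), card_univ, Fintype.card_fun, Fintype.card_coe, hT,
    Fintype.card_fin, smul_eq_mul] at hge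
  omega

/-- The nontrivial sign character of `Fin 2`. -/
def binarySign (x : Fin 2) : ℝ := if x = 0 then 1 else -1

theorem binarySign_mul_self (x : Fin 2) : binarySign x * binarySign x = 1 := by
  unfold binarySign; split_ifs <;> norm_num

/-- The Walsh character of a row `x` on the coordinates in `S`. -/
def walsh {n : ℕ} (x : Fin n → Fin 2) (S : Finset (Fin n)) : ℝ := ∏ j ∈ S, binarySign (x j)

theorem walsh_mul_walsh {n : ℕ} (x : Fin n → Fin 2) (S T : Finset (Fin n)) :
    walsh x S * walsh x T = walsh x (symmDiff S T) := by
  have key : ∀ U : Finset (Fin n), walsh x U = ∏ j, if j ∈ U then binarySign (x j) else 1 :=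
    fun U => by simp [walsh, Finset.prod_ite_mem]
  rw [key, key, key, ← Finset.prod_mul_distrib]
  refine Finset.prod_congr rfl fun j _ => ?_
  by_cases hS : j ∈ S <;> by_cases hT : j ∈ T <;>
    simp [hS, hT, Finset.mem_symmDiff, binarySign_mul_self]

theorem walsh_ne_zero {n : ℕ} (x : Fin n → Fin 2) (S : Finset (Fin n)) : walsh x S ≠ 0 := by
  intro h
  have := walsh_mul_walsh x S S
  rw [h, symmDiff_self] at this
  simp [walsh] at this

open Finset in
/-- A `5`-covering array with at most `48` rows and `13` columns is an orthogonal array of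
strength four. -/
theorem IsCoveringArray.sum_walsh_eq_zero {m : ℕ} {C : Matrix (Fin m) (Fin 13) (Fin 2)}
    (hC : IsCoveringArray 5 C) (hm : m ≤ 48) (U : Finset (Fin 13)) (hU : U.Nonempty)
    (hU4 : #U ≤ 4) : ∑ r, walsh (C r) U = 0 := by
  obtain ⟨a, ha⟩ := hU
  -- On each fiber over `T` the character of `U` is a constant times the sign in column `a`, and
  -- that column is balanced there.
  obtain ⟨T, hUT, hTa, hT⟩ := exists_subsuperset_card_eq (n := 3)
    (erase_subset_erase a (subset_univ U)) (by rw [card_erase_of_mem ha]; omega) (by simp)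
  have haT : a ∉ T := fun h => by simpa using hTa h
  rw [← sum_fiberwise univ (fun r => (fun j : T => C r j))]
  refine sum_eq_zero fun p _ => ?_
  have h6 := hC.card_fiber_eq_six hm T hT p
  have h0 := hC.three_le_card_fiber T hT p h6.le a haT 0
  have h1 := hC.three_le_card_fiber T hT p h6.le a haT 1
  have hd := card_filter_add_card_filter_not (s := {r | (fun j : T => C r j) = p})
    (fun r => C r a = 0)
  have hx : ∀ x : Fin 2, ¬ x = 0 ↔ x = 1 := by decide
  simp only [hx] at hd
  have hsign : ∑ r with (fun j : T => C r j) = p, binarySign (C r a) = 0 := by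
    unfold binarySign
    rw [sum_ite]
    simp only [hx, sum_const, nsmul_eq_mul]
    rw [show #{r ∈ ({r | (fun j : T => C r j) = p} : Finset (Fin m)) | C r a = 0} = 3 by omega,
      show #{r ∈ ({r | (fun j : T => C r j) = p} : Finset (Fin m)) | C r a = 1} = 3 by omega]
    norm_num
  have hfac : ∀ r ∈ ({r | (fun j : T => C r j) = p} : Finset (Fin m)), walsh (C r) U =
      binarySign (C r a) * ∏ j ∈ U.erase a, if h : j ∈ T then binarySign (p ⟨j, h⟩) else 1 := by
    intro r hr
    rw [walsh, ← mul_prod_erase _ _ ha]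
    congr 1
    refine prod_congr rfl fun j hj => ?_
    rw [dif_pos (hUT hj), ← (mem_filter.1 hr).2]
  rw [sum_congr rfl hfac, ← sum_mul, hsign, zero_mul]

open Finset in
theorem IsCoveringArray.forty_nine_le {m : ℕ} {C : Matrix (Fin m) (Fin 13) (Fin 2)}
    (hC : IsCoveringArray 5 C) : 49 ≤ m := by
  by_contra! hlt
  have hm : m ≤ 48 := by omega
  -- Some row must exist for the vectors `v S` to be nonzero.
  obtain ⟨r₀, -⟩ := hC.exists_row (by norm_num) ∅ (by simp) 0
  -- Distinct pairs have a nonempty symmetric difference of size at most 4, so strength four makes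
  -- these vectors orthogonal.
  let v : (powersetCard 2 (univ : Finset (Fin 13))) → EuclideanSpace ℝ (Fin m) :=
    fun S => WithLp.toLp 2 fun r => walsh (C r) S
  have hv : LinearIndependent ℝ v := by
    refine linearIndependent_of_ne_zero_of_inner_eq_zero (fun S h => ?_) fun S T hST => ?_
    · exact walsh_ne_zero (C r₀) S (congrArg (fun w : EuclideanSpace ℝ (Fin m) => w r₀) h)
    · have hS := (mem_powersetCard.1 S.2).2
      have hT := (mem_powersetCard.1 T.2).2
      have hcard : #(symmDiff T.1 S.1) ≤ 4 := by
        refine (card_le_card (symmDiff_le_sup (a := T.1) (b := S.1))).trans ?_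
        exact (card_union_le _ _).trans (by omega)
      simp only [v, PiLp.inner_apply, RCLike.inner_apply, conj_trivial, walsh_mul_walsh]
      refine hC.sum_walsh_eq_zero hm _ ?_ hcard
      rw [nonempty_iff_ne_empty]
      intro h
      exact hST (Subtype.ext (symmDiff_eq_bot.1 h).symm)
  have := hv.fintype_card_le_finrank
  rw [Fintype.card_coe, card_powersetCard, card_univ, Fintype.card_fin, finrank_euclideanSpace,
    Fintype.card_fin, show Nat.choose 13 2 = 78 by decide] at this
  omega

theorem theorem5p9 :
    (¬ ∃ C : Matrix (Fin 48) (Fin 13) (Fin 2), IsCoveringArray 5 C) ∧ 49 ≤ CAN 5 13 2 := by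
  refine ⟨fun ⟨C, hC⟩ => absurd hC.forty_nine_le (by norm_num), ?_⟩
  obtain ⟨C, hC⟩ := exists_isCoveringArray 5 13 2 two_pos
  exact hC.forty_nine_le
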